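/- \textbf{Definitions.} Identify a configuration $X\subset\mathbb Z_{\ge0}$ with a point of $\mathrm{Conf}(\mathbb Z_{\ge0})=\{0,1\}^{\mathbb Z_{\ge0}}$, with the product topology and its Borel $\sigma$-algebra. A probability measure $\mathbb P$ on $\mathrm{Conf}(\mathbb Z_{\ge0})$ is \emph{determinantal with correlation kernel} $K:\mathbb Z_{\ge0}\times\mathbb Z_{\ge0}\to\mathbb R$ if for every finite set of distinct points $x_1,\dots,x_k\in\mathbb Z_{\ge0}$ $$\mathbb P\big(\{X:\ x_1,\dots,x_k\in X\}\big)=\det\big[K(x_i,x_j)\big]_{i,j=1}^k .$$ For $\theta>0$ let $W_\theta(x)=\theta^x/x!$, $x\in\mathbb Z_{\ge0}$, and let $C_n(x)=\sum_{k=0}^n\binom nk(-1/\theta)^k\,x(x-1)\cdots(x-k+1)$, $n\ge0$, be the Charlier polynomials, which are orthogonal on $\mathbb Z_{\ge0}$ with respect to $W_\theta$. For $N\ge1$, the $N$-particle Charlier ensemble $\mathrm{Charlier}(N,\theta)$ is the determinantal measure with correlation kernel $$K_{N,\theta}(x,y)=\sqrt{W_\theta(x)W_\theta(y)}\;\sum_{n=0}^{N-1}\frac{C_n(x)C_n(y)}{\sum_{z\ge0}W_\theta(z)C_n(z)^2}.$$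 For $r\in\mathbb R$, the discrete Hermite ensemble $\mathrm{DH}^+(r)$ is the determinantal measure with correlation kernel $$K_{\mathrm{DH}^+(r)}(x,y)=\big(\pi\,2^{x+y}\,x!\,y!\big)^{-1/2}\int_r^{+\infty}H_x(t)H_y(t)e^{-t^2}\,dt,$$ where $H_n$ are the Hermite polynomials, orthogonal with respect to $e^{-t^2}dt$ on $\mathbb R$ and with leading coefficient $2^n$. \textbf{Theorem.} Fix $r\in\mathbb R$ and let $\theta_N>0$ $(N=1,2,\dots)$ satisfy $$\frac{\theta_N-N}{\sqrt N}\longrightarrow\sqrt2\,r\qquad(N\to\infty).$$ Then the determinantal measures $\mathrm{Charlier}(N,\theta_N)$, $N\ge1$, and $\mathrm{DH}^+(r)$ exist and are uniquely determined by their correlation kernels, and $\mathrm{Charlier}(N,\theta_N)$ converges weakly to $\mathrm{DH}^+(r)$ as $N\to\infty$, as probability measures on $\mathrm{Conf}(\mathbb Z_{\ge0})$. -/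

import Mathlib

open MeasureTheory Filter Topology

noncomputable section

/-- Point configurations in a countable discrete space `α`, that is, the set `2 ^ α` of all subsets
of `α`: the configuration `X` contains the point `x` if and only if `X x = true`. As a product of
copies of the two-point discrete space it carries the product topology (in which it is compact and
totally disconnected) and the product sigma-algebra, which is the Borel one. -/
abbrev Conf (α : Type*) : Type _ := α → Bool

/-- The set of all configurations that contain the given finite set `Y`. -/
def cylinder {α : Type*} (Y : Finset α) : Set (Conf α) := {X | ∀ x ∈ Y, X x = true}

/-- `P` is the determinantal measure on `Conf α` with correlation kernel `K` (with respect to the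
counting measure on `α`): for distinct points `x₁, …, x_k` the value of the correlation function,
which is the probability that the random configuration contains all of them, equals
`det [K (x_i) (x_j)]`. -/
def IsDeterminantal {α : Type*} [DecidableEq α] (K : α → α → ℝ) (P : ProbabilityMeasure (Conf α)) : Prop :=
  ∀ Y : Finset α, (P : Measure (Conf α)).real (cylinder Y) =
    Matrix.det (Matrix.of fun x y : {a // a ∈ Y} => K x.1 y.1)

/-- The Christoffel-Darboux kernel of order `N`, with respect to the counting measure on `ℕ`, of
polynomials `p 0, p 1, …` that are orthogonal with respect to the weight `W` on `ℕ`; the denominator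
is the squared norm of `p n` in the weighted space `ℓ²(ℕ, W)`. -/
def orthogonalPolynomialKernel (W : ℕ → ℝ) (p : ℕ → Polynomial ℝ) (N : ℕ) (x y : ℕ) : ℝ :=
  √(W x * W y) * ∑ n ∈ Finset.range N,
    (p n).eval (x : ℝ) * (p n).eval (y : ℝ) / ∑' z : ℕ, W z * (p n).eval (z : ℝ) ^ 2

/-- The Charlier weight `θ ^ x / x!` on `ℕ`. -/
def charlierWeight (θ : ℝ) (x : ℕ) : ℝ := θ ^ x / (x.factorial : ℝ)

/-- The Charlier polynomial `C_n(x; θ) = ₂F₀(-n, -x; ; -1/θ)`, written as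
`∑ k ≤ n, (n choose k) (-1/θ)^k x (x - 1) ⋯ (x - k + 1)`. -/
def charlierPoly (θ : ℝ) (n : ℕ) : Polynomial ℝ :=
  ∑ k ∈ Finset.range (n + 1),
    Polynomial.C ((n.choose k : ℝ) * (-(1 / θ)) ^ k) * descPochhammer ℝ k

/-- `P` is the `N`-particle Charlier orthogonal polynomial ensemble with parameter `θ`. -/
def IsCharlierEnsemble (N : ℕ) (θ : ℝ) (P : ProbabilityMeasure (Conf ℕ)) : Prop :=
  IsDeterminantal (orthogonalPolynomialKernel (charlierWeight θ) (charlierPoly θ) N) P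

/-- The value at `t` of the Hermite polynomial `H_n` in the standardization in which the weight is
`exp (-t²)` and the leading coefficient is `2 ^ n`. It is obtained from Mathlib's `He_n` (weight
`exp (-t² / 2)`, leading coefficient `1`) as `H_n(t) = 2^{n/2} He_n(√2 t)`. -/
def hermiteH (n : ℕ) (t : ℝ) : ℝ :=
  √2 ^ n * Polynomial.aeval (√2 * t) (Polynomial.hermite n)

/-- The discrete Hermite kernel, for the interval `(r, ∞)`. -/
def discreteHermiteKernelPlus (r : ℝ) (x y : ℕ) : ℝ :=
  (√(Real.pi * 2 ^ (x + y) * (x.factorial : ℝ) * (y.factorial : ℝ)))⁻¹ *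
    ∫ t in Set.Ioi r, hermiteH x t * hermiteH y t * Real.exp (-t ^ 2)

/-- `P` is the discrete Hermite ensemble `DH⁺(r)`. -/
def IsDiscreteHermiteEnsemblePlus (r : ℝ) (P : ProbabilityMeasure (Conf ℕ)) : Prop :=
  IsDeterminantal (discreteHermiteKernelPlus r) P

end

noncomputable section

/-! ### Determinants of matrices with nonnegative quadratic form -/

/-! Charlier polynomials are self-dual, `C_n(x) = C_x(n)`, with squared norm `e^θ n! / θ^n`. The
`N`-particle kernel at `(x, y)` is therefore, up to a prefactor, the integral of `C_x(n) C_y(n)`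
over `{n < N}` against the Poisson law of parameter `θ`: the degrees are now fixed and only the
measure and the cutoff move. With `s = (θ - n) / √(2θ)` the Poisson law tends to `e^{-s²} ds / √π`,
the event `n < N` becomes a half-line whose endpoint tends to `r`, and the rescaled polynomials tend
coefficientwise to Hermite polynomials. Exponential moments bounded uniformly in `θ ≥ 1` and the
absence of an atom at `r` justify the limit of the integrals (`tendsto_setIntegral_Ioi_eval`), which
gives `tendsto_charlierKernel`.

Passing from kernels to measures is soft. Cylinder events are clopen and determine the measure, and
the space of probability measures on `Conf α` is compact, so entrywise convergence of kernels
implies weak convergence (`IsDeterminantal.tendsto`). Existence holds for symmetric kernels with `0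
≤ K ≤ 1`: explicit determinantal weights on finite windows, then compactness. Charlier kernels are
projections, and the discrete Hermite kernel inherits the bounds as their limit. -/

theorem Matrix.det_nonneg_of_forall_dotProduct_mulVec_nonneg {ι : Type*} [Fintype ι]
    [DecidableEq ι] (M : Matrix ι ι ℝ) (hM : ∀ v : ι → ℝ, 0 ≤ v ⬝ᵥ M.mulVec v) : 0 ≤ M.det := by
  by_contra! hneg
  -- Symmetry of `M` is not available. On the segment from `1` to `M` the determinant would change
  -- sign, hence vanish; pairing a null vector with its image forces `t = 1`, where the determinant
  -- is negative by assumption.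
  have hcont : Continuous fun t : ℝ => ((1 - t) • (1 : Matrix ι ι ℝ) + t • M).det := by
    fun_prop
  have h0 : (0 : ℝ) ∈ Set.Icc
      ((((1 - (1 : ℝ)) • (1 : Matrix ι ι ℝ) + (1 : ℝ) • M)).det)
      ((((1 - (0 : ℝ)) • (1 : Matrix ι ι ℝ) + (0 : ℝ) • M)).det) := by
    simp [hneg.le]
  obtain ⟨t, ht, hdet⟩ := intermediate_value_Icc' zero_le_one hcont.continuousOn h0
  obtain ⟨v, hv, hMv⟩ := Matrix.exists_mulVec_eq_zero_iff.mpr hdet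
  have hvv : 0 < v ⬝ᵥ v := by
    exact lt_of_le_of_ne (Finset.sum_nonneg fun i _ => mul_self_nonneg _)
      fun h => hv (dotProduct_self_eq_zero.mp h.symm)
  have key : (1 - t) * (v ⬝ᵥ v) + t * (v ⬝ᵥ M.mulVec v) = 0 := by
    have := congrArg (fun w => v ⬝ᵥ w) hMv
    simpa [Matrix.add_mulVec, Matrix.smul_mulVec, dotProduct_add, dotProduct_smul] using this
  have ht1 : t = 1 := by
    rcases ht.2.lt_or_eq with h | h
    · have := mul_pos (sub_pos.mpr h) hvv
      have := mul_nonneg ht.1 (hM v)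
      linarith
    · exact h
  subst ht1
  simp at hdet
  linarith

/-- The matrix whose rows indexed by `S` are those of `K` and whose other rows are those
of `1 - K`. -/
def mixedMatrix {ι : Type*} [Fintype ι] [DecidableEq ι] (K : Matrix ι ι ℝ) (S : Finset ι) :
    Matrix ι ι ℝ :=
  Matrix.of fun i j => if i ∈ S then K i j else (1 - K) i j

/-- These determinants will be the probabilities that the configuration in a finite window is
exactly `S`. Splitting `v = a + b` along `S`, the cross terms cancel by symmetry of `K`, leaving
`⟨a, K a⟩ + ⟨b, (1 - K) b⟩`. -/
theorem det_mixedMatrix_nonneg {ι : Type*} [Fintype ι] [DecidableEq ι] (K : Matrix ι ι ℝ)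
    (hsymm : ∀ i j, K i j = K j i)
    (h0 : ∀ v : ι → ℝ, 0 ≤ ∑ i, ∑ j, v i * K i j * v j)
    (h1 : ∀ v : ι → ℝ, ∑ i, ∑ j, v i * K i j * v j ≤ ∑ i, v i ^ 2) (S : Finset ι) :
    0 ≤ (mixedMatrix K S).det := by
  apply Matrix.det_nonneg_of_forall_dotProduct_mulVec_nonneg
  intro v
  let a : ι → ℝ := fun i => if i ∈ S then v i else 0
  let b : ι → ℝ := fun i => if i ∈ S then 0 else v i
  have hab : ∑ i, ∑ j, a i * K i j * b j = ∑ i, ∑ j, b i * K i j * a j := by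
    rw [Finset.sum_comm]
    refine Finset.sum_congr rfl fun i _ => Finset.sum_congr rfl fun j _ => ?_
    rw [hsymm j i]; ring
  have hrow : ∀ i, v i * (mixedMatrix K S).mulVec v i =
      (∑ j, a i * K i j * a j) + (∑ j, a i * K i j * b j) + b i ^ 2
        - (∑ j, b i * K i j * a j) - ∑ j, b i * K i j * b j := by
    intro i
    have hv : ∀ j, v j = a j + b j := fun j => by by_cases hj : j ∈ S <;> simp [a, b, hj]
    have hKv : K.mulVec v i = (∑ j, K i j * a j) + ∑ j, K i j * b j := by
      simp only [Matrix.mulVec, dotProduct, ← Finset.sum_add_distrib]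
      exact Finset.sum_congr rfl fun j _ => by rw [hv j]; ring
    simp only [mul_assoc, ← Finset.mul_sum]
    by_cases hi : i ∈ S
    · have : (mixedMatrix K S).mulVec v i = K.mulVec v i := by
        simp [mixedMatrix, Matrix.mulVec, hi]
      rw [this, hKv]
      simp only [a, b, hi, if_true]
      ring
    · have : (mixedMatrix K S).mulVec v i = v i - K.mulVec v i := by
        have : (mixedMatrix K S).mulVec v i = (1 - K : Matrix ι ι ℝ).mulVec v i := by
          simp [mixedMatrix, Matrix.mulVec, hi]
        rw [this, Matrix.sub_mulVec]; simp
      rw [this, hKv]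
      simp only [a, b, hi, if_false]
      ring
  have : v ⬝ᵥ (mixedMatrix K S).mulVec v =
      (∑ i, ∑ j, a i * K i j * a j) + ((∑ i, b i ^ 2) - ∑ i, ∑ j, b i * K i j * b j) := by
    simp only [dotProduct, hrow, Finset.sum_add_distrib, Finset.sum_sub_distrib, hab]
    ring
  rw [this]
  exact add_nonneg (h0 a) (sub_nonneg.mpr (h1 b))

/-- Inclusion-exclusion as multilinearity in the rows: a row outside `p` may be taken from `K` or
from `1 - K`, and the two choices add up to a row of the identity. -/
theorem sum_det_mixedMatrix {ι : Type*} [Fintype ι] [DecidableEq ι] (K : Matrix ι ι ℝ)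
    (p : ι → Prop) [DecidablePred p] :
    ∑ S : Finset ι, (if ∀ i, p i → i ∈ S then (mixedMatrix K S).det else 0) =
      (K.toSquareBlockProp p).det := by
  -- Zero rows on `p` kill every `S` that misses a point of `p`, so the restricted sum becomes the
  -- full expansion of `det (K + m')`.
  let m' : Matrix ι ι ℝ := Matrix.of fun i j => if p i then 0 else (1 - K) i j
  have hS : ∀ S : Finset ι, (if ∀ i, p i → i ∈ S then (mixedMatrix K S).det else 0) =
      Matrix.det (Matrix.of (S.piecewise K m')) := by
    intro S
    split_ifs with h
    · congr 1
      ext i j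
      by_cases hi : i ∈ S
      · simp [mixedMatrix, Finset.piecewise, hi]
      · have : ¬ p i := fun hp => hi (h i hp)
        simp [mixedMatrix, Finset.piecewise, m', hi, this]
    · push Not at h
      obtain ⟨i, hp, hi⟩ := h
      exact (Matrix.det_eq_zero_of_row_eq_zero i fun j => by simp [Finset.piecewise, m', hi, hp]).symm
  have hsum := (Matrix.detRowAlternating (n := ι) (R := ℝ)).toMultilinearMap.map_add_univ K m'
  simp only [hS]
  refine hsum.symm.trans ?_
  change Matrix.det (K + m') = _
  have hrow : ∀ i, ¬ p i → ∀ j, (K + m') i j = (1 : Matrix ι ι ℝ) i j := by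
    intro i hi j
    simp [m', hi]
  rw [Matrix.twoBlockTriangular_det (K + m') p]
  · have h1 : (K + m').toSquareBlockProp p = K.toSquareBlockProp p := by
      ext i j
      simp [Matrix.toSquareBlockProp, m', i.2]
    have h2 : (K + m').toSquareBlockProp (fun i => ¬ p i) = 1 := by
      ext i j
      rw [Matrix.toSquareBlockProp_def, Matrix.of_apply, hrow _ i.2]
      simp [Matrix.one_apply, Subtype.ext_iff]
    rw [h1, h2, Matrix.det_one, mul_one]
  · intro i hi j hj
    rw [hrow i hi, Matrix.one_apply_ne]
    rintro rfl
    exact hi hj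

/-! ### Determinantal measures -/


/-! ### Determinantal measures -/

theorem measurableSet_cylinder {α : Type*} (Y : Finset α) : MeasurableSet (_root_.cylinder Y) := by
  have : _root_.cylinder Y = ⋂ x ∈ Y, (fun X : Conf α => X x) ⁻¹' {true} := by
    ext X; simp [_root_.cylinder]
  rw [this]
  exact Finset.measurableSet_biInter _ fun x _ => measurable_pi_apply x (measurableSet_singleton _)

theorem isClopen_cylinder {α : Type*} (Y : Finset α) : IsClopen (_root_.cylinder Y) := by
  have : _root_.cylinder Y = ⋂ x ∈ Y, (fun X : Conf α => X x) ⁻¹' {true} := by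
    ext X; simp [_root_.cylinder]
  rw [this]
  exact isClopen_biInter_finset fun x _ => (isClopen_discrete _).preimage (continuous_apply x)

theorem ProbabilityMeasure.ext_of_cylinder {α : Type*} [DecidableEq α]
    {P Q : ProbabilityMeasure (Conf α)}
    (h : ∀ Y : Finset α, (P : Measure (Conf α)).real (_root_.cylinder Y) =
      (Q : Measure (Conf α)).real (_root_.cylinder Y)) : P = Q := by
  apply Subtype.ext
  change (P : Measure (Conf α)) = Q
  refine ext_of_generate_finite (Set.range (_root_.cylinder (α := α))) ?_ ?_ ?_ (by simp)
  · refine le_antisymm ?_ (MeasurableSpace.generateFrom_le ?_)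
    · refine iSup_le fun x => ?_
      rw [← measurable_iff_comap_le]
      refine measurable_to_bool ?_
      refine MeasurableSpace.measurableSet_generateFrom ⟨{x}, ?_⟩
      ext X; simp [_root_.cylinder]
    · rintro _ ⟨Y, rfl⟩
      exact measurableSet_cylinder Y
  · rintro _ ⟨Y, rfl⟩ _ ⟨Z, rfl⟩ _
    refine ⟨Y ∪ Z, ?_⟩
    ext X
    simp only [_root_.cylinder, Finset.mem_union, Set.mem_ofPred_eq, Set.mem_inter_iff]
    grind
  · rintro _ ⟨Y, rfl⟩
    exact (measureReal_eq_measureReal_iff).mp (h Y)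

theorem IsDeterminantal.unique {α : Type*} [DecidableEq α] {K : α → α → ℝ}
    {P Q : ProbabilityMeasure (Conf α)} (hP : IsDeterminantal K P) (hQ : IsDeterminantal K Q) :
    P = Q :=
  ProbabilityMeasure.ext_of_cylinder fun Y => (hP Y).trans (hQ Y).symm

theorem tendsto_measureReal_cylinder {α ι : Type*} [Countable α] {l : Filter ι}
    {P : ι → ProbabilityMeasure (Conf α)} {Q : ProbabilityMeasure (Conf α)}
    (h : Tendsto P l (𝓝 Q)) (Y : Finset α) :
    Tendsto (fun i => (P i : Measure (Conf α)).real (_root_.cylinder Y)) l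
      (𝓝 ((Q : Measure (Conf α)).real (_root_.cylinder Y))) := by
  have := ProbabilityMeasure.tendsto_measure_of_isClopen_of_tendsto h (isClopen_cylinder Y)
  simpa using (NNReal.tendsto_coe.mpr this)

/-- By compactness it is enough to identify cluster points; along an ultrafilter converging to one,
clopenness makes its cylinder probabilities the prescribed limits. -/
theorem tendsto_of_tendsto_cylinder {α ι : Type*} [Countable α] [DecidableEq α] {l : Filter ι}
    {P : ι → ProbabilityMeasure (Conf α)} {Q : ProbabilityMeasure (Conf α)}
    (h : ∀ Y : Finset α, Tendsto (fun i => (P i : Measure (Conf α)).real (_root_.cylinder Y)) l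
      (𝓝 ((Q : Measure (Conf α)).real (_root_.cylinder Y)))) : Tendsto P l (𝓝 Q) := by
  refine tendsto_nhds_of_unique_mapClusterPt fun R hR => ?_
  obtain ⟨U, hU, hUR⟩ := mapClusterPt_iff_ultrafilter.mp hR
  exact ProbabilityMeasure.ext_of_cylinder fun Y =>
    tendsto_nhds_unique (tendsto_measureReal_cylinder hUR Y) ((h Y).mono_left hU)

theorem IsDeterminantal.tendsto {α ι : Type*} [Countable α] [DecidableEq α] {l : Filter ι}
    {K : ι → α → α → ℝ} {K₀ : α → α → ℝ}
    {P : ι → ProbabilityMeasure (Conf α)} {Q : ProbabilityMeasure (Conf α)}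
    (hP : ∀ᶠ i in l, IsDeterminantal (K i) (P i)) (hQ : IsDeterminantal K₀ Q)
    (hK : ∀ x y, Tendsto (fun i => K i x y) l (𝓝 (K₀ x y))) : Tendsto P l (𝓝 Q) := by
  refine tendsto_of_tendsto_cylinder fun Y => ?_
  rw [hQ Y]
  have hdet : Continuous fun M : Matrix {a // a ∈ Y} {a // a ∈ Y} ℝ => M.det := by fun_prop
  have hM : Tendsto (fun i => (Matrix.of fun x y : {a // a ∈ Y} => K i x.1 y.1)) l
      (𝓝 (Matrix.of fun x y : {a // a ∈ Y} => K₀ x.1 y.1)) :=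
    tendsto_pi_nhds.mpr fun x => tendsto_pi_nhds.mpr fun y => hK x.1 y.1
  refine ((hdet.tendsto _).comp hM).congr' ?_
  filter_upwards [hP] with i hi
  exact (hi Y).symm

/-- A symmetric kernel whose quadratic form lies between `0` and the squared `ℓ²` norm on finitely
supported vectors. -/
structure IsContractionKernel {α : Type*} (K : α → α → ℝ) : Prop where
  symm : ∀ x y, K x y = K y x
  nonneg : ∀ (Y : Finset α) (v : α → ℝ), 0 ≤ ∑ x ∈ Y, ∑ y ∈ Y, v x * K x y * v y
  le : ∀ (Y : Finset α) (v : α → ℝ), ∑ x ∈ Y, ∑ y ∈ Y, v x * K x y * v y ≤ ∑ x ∈ Y, v x ^ 2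

/-- Each condition involves finitely many entries, so it is closed under pointwise limits. This
spares any use of Hermite orthogonality. -/
theorem IsContractionKernel.of_tendsto {α ι : Type*} {l : Filter ι} [l.NeBot]
    {K : ι → α → α → ℝ} {K₀ : α → α → ℝ} (hK : ∀ᶠ i in l, IsContractionKernel (K i))
    (h : ∀ x y, Tendsto (fun i => K i x y) l (𝓝 (K₀ x y))) : IsContractionKernel K₀ := by
  have hform : ∀ (Y : Finset α) (v : α → ℝ),
      Tendsto (fun i => ∑ x ∈ Y, ∑ y ∈ Y, v x * K i x y * v y) l
        (𝓝 (∑ x ∈ Y, ∑ y ∈ Y, v x * K₀ x y * v y)) := fun Y v =>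
    tendsto_finsetSum _ fun x _ => tendsto_finsetSum _ fun y _ =>
      ((h x y).const_mul _).mul_const _
  refine ⟨fun x y => ?_, fun Y v => ?_, fun Y v => ?_⟩
  · exact tendsto_nhds_unique_of_eventuallyEq (h x y) (h y x) (hK.mono fun i hi => hi.symm x y)
  · exact ge_of_tendsto (hform Y v) (hK.mono fun i hi => hi.nonneg Y v)
  · exact le_of_tendsto (hform Y v) (hK.mono fun i hi => hi.le Y v)

theorem IsContractionKernel.exists_measure_cylinder_eq {α : Type*} [DecidableEq α]
    {K : α → α → ℝ} (hK : IsContractionKernel K) (L : Finset α) :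
    ∃ P : ProbabilityMeasure (Conf α), ∀ Y : Finset α, Y ⊆ L →
      (P : Measure (Conf α)).real (_root_.cylinder Y) =
        Matrix.det (Matrix.of fun x y : {a // a ∈ Y} => K x.1 y.1) := by
  let M : Matrix {a // a ∈ L} {a // a ∈ L} ℝ := Matrix.of fun x y => K x.1 y.1
  have hext : ∀ v : {a // a ∈ L} → ℝ, ∃ u : α → ℝ, ∀ x : {a // a ∈ L}, u x = v x := fun v =>
    ⟨fun a => if h : a ∈ L then v ⟨a, h⟩ else 0, fun x => by simp⟩
  have hsum : ∀ (v : {a // a ∈ L} → ℝ) (u : α → ℝ), (∀ x : {a // a ∈ L}, u x = v x) →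
      ∑ x, ∑ y, v x * M x y * v y = ∑ x ∈ L, ∑ y ∈ L, u x * K x y * u y := by
    intro v u hu
    rw [← Finset.sum_coe_sort L]
    refine Finset.sum_congr rfl fun x _ => ?_
    rw [← Finset.sum_coe_sort L]
    exact Finset.sum_congr rfl fun y _ => by rw [hu x, hu y]; rfl
  have hw : ∀ S, 0 ≤ (mixedMatrix M S).det := by
    refine det_mixedMatrix_nonneg M (fun x y => hK.symm _ _) (fun v => ?_) (fun v => ?_)
    · obtain ⟨u, hu⟩ := hext v
      rw [hsum v u hu]
      exact hK.nonneg L u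
    · obtain ⟨u, hu⟩ := hext v
      rw [hsum v u hu]
      refine (hK.le L u).trans_eq ?_
      rw [← Finset.sum_coe_sort L]
      exact Finset.sum_congr rfl fun x _ => by rw [hu x]
  let conf : Finset {a // a ∈ L} → Conf α := fun S x =>
    decide (x ∈ S.map (Function.Embedding.subtype _))
  -- Configurations contained in `L`, each weighted by its mixed determinant.
  let μ : Measure (Conf α) :=
    ∑ S, ENNReal.ofReal (mixedMatrix M S).det • Measure.dirac (conf S)
  have hμ : ∀ Y : Finset α, Y ⊆ L → μ (_root_.cylinder Y) =
      ENNReal.ofReal (Matrix.det (Matrix.of fun x y : {a // a ∈ Y} => K x.1 y.1)) := by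
    intro Y hY
    have hmem : ∀ S, conf S ∈ _root_.cylinder Y ↔ ∀ x : {a // a ∈ L}, x.1 ∈ Y → x ∈ S := by
      intro S
      simp only [_root_.cylinder, Set.mem_ofPred_eq, conf, decide_eq_true_eq, Finset.mem_map,
        Function.Embedding.coe_subtype]
      refine ⟨fun h x hx => ?_, fun h x hx => ⟨⟨x, hY hx⟩, h _ hx, rfl⟩⟩
      obtain ⟨y, hy, hxy⟩ := h x.1 hx
      rwa [← Subtype.ext hxy]
    have hdet : (M.toSquareBlockProp fun x => x.1 ∈ Y).det =
        Matrix.det (Matrix.of fun x y : {a // a ∈ Y} => K x.1 y.1) := by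
      let e : {x : {a // a ∈ L} // x.1 ∈ Y} ≃ {a // a ∈ Y} :=
        Equiv.subtypeSubtypeEquivSubtype fun h => hY h
      rw [← Matrix.det_submatrix_equiv_self e]
      rfl
    rw [← hdet, ← sum_det_mixedMatrix, ENNReal.ofReal_sum_of_nonneg]
    · simp only [μ, Measure.finsetSum_apply, Measure.smul_apply, smul_eq_mul,
        Measure.dirac_apply' _ (measurableSet_cylinder Y)]
      refine Finset.sum_congr rfl fun S _ => ?_
      by_cases h : ∀ x : {a // a ∈ L}, x.1 ∈ Y → x ∈ S
      · rw [if_pos h, Set.indicator_of_mem ((hmem S).mpr h)]; simp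
      · rw [if_neg h, Set.indicator_of_notMem (fun h' => h ((hmem S).mp h'))]; simp
    · intro S _
      split_ifs
      exacts [hw S, le_rfl]
  have hprob : IsProbabilityMeasure μ := by
    refine ⟨?_⟩
    have : (_root_.cylinder ∅ : Set (Conf α)) = Set.univ := by ext; simp [_root_.cylinder]
    rw [← this, hμ ∅ (Finset.empty_subset L)]
    simp
  refine ⟨⟨μ, hprob⟩, fun Y hY => ?_⟩
  change μ.real (_root_.cylinder Y) = _
  rw [measureReal_def, hμ Y hY, ENNReal.toReal_ofReal]
  refine Matrix.det_nonneg_of_forall_dotProduct_mulVec_nonneg _ fun v => ?_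
  have := hK.nonneg Y fun a => if h : a ∈ Y then v ⟨a, h⟩ else 0
  rw [← Finset.sum_coe_sort Y] at this
  refine this.trans_eq ?_
  simp only [dotProduct, Matrix.mulVec, Finset.mul_sum]
  refine Finset.sum_congr rfl fun x _ => ?_
  rw [← Finset.sum_coe_sort Y]
  exact Finset.sum_congr rfl fun y _ => by simp [mul_assoc]

/-- A cluster point of the window measures as `L` grows takes the place of Kolmogorov extension: the
probability of the cylinder of `Y` is constant once `L ⊇ Y`. -/
theorem IsContractionKernel.existsUnique_isDeterminantal {α : Type*} [Countable α] [DecidableEq α]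
    {K : α → α → ℝ} (hK : IsContractionKernel K) :
    ∃! P : ProbabilityMeasure (Conf α), IsDeterminantal K P := by
  choose P hP using hK.exists_measure_cylinder_eq
  obtain ⟨Q, -, hQ⟩ := isCompact_univ.exists_mapClusterPt (f := (atTop : Filter (Finset α))) (u := P)
    (by simp)
  obtain ⟨U, hU, hUQ⟩ := mapClusterPt_iff_ultrafilter.mp hQ
  have hdet : IsDeterminantal K Q := fun Y => by
    refine tendsto_nhds_unique_of_eventuallyEq (tendsto_measureReal_cylinder hUQ Y)
      tendsto_const_nhds ?_
    exact hU ((eventually_ge_atTop Y).mono fun L hL => hP L Y hL)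
  exact ⟨Q, hdet, fun R hR => hR.unique hdet⟩

/-! ### Charlier polynomials at integer points -/

theorem summable_charlierWeight_mul_eval (θ : ℝ) (p : Polynomial ℝ) :
    Summable fun z : ℕ => charlierWeight θ z * p.eval (z : ℝ) := by
  induction p using Polynomial.induction_on' with
  | add p q hp hq => simpa [mul_add] using hp.add hq
  | monomial k c =>
    have hs := ((Real.summable_pow_div_factorial (|θ| * Real.exp 1)).mul_left
      (|c| * (k.factorial : ℝ)))
    refine Summable.of_norm_bounded hs fun z => ?_
    have hz : (z : ℝ) ^ k ≤ (k.factorial : ℝ) * Real.exp 1 ^ z := by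
      have := Real.pow_div_factorial_le_exp (z : ℝ) (Nat.cast_nonneg z) k
      rw [div_le_iff₀ (by positivity)] at this
      rw [← Real.exp_nat_mul]
      simpa [mul_comm] using this
    rw [Polynomial.eval_monomial, charlierWeight, norm_mul, norm_div, norm_pow, norm_mul,
      norm_pow, Real.norm_natCast, Real.norm_natCast, Real.norm_eq_abs, Real.norm_eq_abs, mul_pow]
    calc |θ| ^ z / (z.factorial : ℝ) * (|c| * (z : ℝ) ^ k)
        ≤ |θ| ^ z / (z.factorial : ℝ) * (|c| * ((k.factorial : ℝ) * Real.exp 1 ^ z)) := by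
          gcongr
      _ = _ := by ring

/-- The summand is symmetric in `m` and `x`; the free upper limit `L` allows a common range for
both, whence self-duality. -/
theorem charlierPoly_eval_eq_sum {θ : ℝ} {m L : ℕ} (h : m ≤ L) (x : ℕ) :
    (charlierPoly θ m).eval (x : ℝ) = ∑ k ∈ Finset.range (L + 1),
      (k.factorial * m.choose k * x.choose k : ℝ) * (-(1 / θ)) ^ k := by
  have hL : ∑ k ∈ Finset.range (L + 1),
      (k.factorial * m.choose k * x.choose k : ℝ) * (-(1 / θ)) ^ k =
      ∑ k ∈ Finset.range (m + 1),
        (k.factorial * m.choose k * x.choose k : ℝ) * (-(1 / θ)) ^ k := by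
    symm
    apply Finset.sum_subset (Finset.range_mono (by omega))
    intro k _ hk
    rw [Nat.choose_eq_zero_of_lt (by simpa using hk)]
    simp
  rw [hL, charlierPoly, Polynomial.eval_finsetSum]
  refine Finset.sum_congr rfl fun k _ => ?_
  rw [Polynomial.eval_mul, Polynomial.eval_C, descPochhammer_eval_eq_descFactorial,
    Nat.descFactorial_eq_factorial_mul_choose]
  push_cast
  ring

theorem charlierPoly_eval_comm (θ : ℝ) (m x : ℕ) :
    (charlierPoly θ m).eval (x : ℝ) = (charlierPoly θ x).eval (m : ℝ) := by
  rw [charlierPoly_eval_eq_sum (le_max_left m x), charlierPoly_eval_eq_sum (le_max_right m x)]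
  exact Finset.sum_congr rfl fun k _ => by ring

@[simp]
theorem charlierPoly_zero_eval (θ x : ℝ) : (charlierPoly θ 0).eval x = 1 := by
  simp [charlierPoly]

@[simp]
theorem charlierPoly_eval_zero (θ : ℝ) (m : ℕ) : (charlierPoly θ m).eval 0 = 1 := by
  simpa using charlierPoly_eval_comm θ m 0

theorem charlierPoly_succ_eval_succ (θ : ℝ) (m x : ℕ) :
    (charlierPoly θ (m + 1)).eval ((x + 1 : ℕ) : ℝ) = (charlierPoly θ (m + 1)).eval (x : ℝ) -
      (m + 1) / θ * (charlierPoly θ m).eval (x : ℝ) := by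
  rw [charlierPoly_eval_eq_sum (le_refl (m + 1)), charlierPoly_eval_eq_sum (le_refl (m + 1)),
    charlierPoly_eval_eq_sum (le_refl m), Finset.sum_range_succ', Finset.sum_range_succ' _ (m + 1),
    Finset.mul_sum, add_sub_right_comm, ← Finset.sum_sub_distrib]
  congr 1
  · refine Finset.sum_congr rfl fun k _ => ?_
    have h1 : ((k + 1 : ℕ) : ℝ) * ((m + 1).choose (k + 1) : ℝ) = (m + 1) * m.choose k := by
      have := Nat.add_one_mul_choose_eq m k
      rw [mul_comm]
      exact_mod_cast this.symm
    rw [Nat.choose_succ_succ x k, Nat.factorial_succ, pow_succ]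
    push_cast at h1 ⊢
    linear_combination (x.choose k * k.factorial * (-(1 / θ)) ^ (k + 1) : ℝ) * h1
  · simp

/-- The self-dual image of the preceding difference relation: it shifts the degree instead of the
argument. -/
theorem charlierPoly_succ_eval_succ' (θ : ℝ) (m x : ℕ) :
    (charlierPoly θ (m + 1)).eval ((x + 1 : ℕ) : ℝ) = (charlierPoly θ m).eval ((x + 1 : ℕ) : ℝ) -
      (x + 1) / θ * (charlierPoly θ m).eval (x : ℝ) := by
  rw [charlierPoly_eval_comm, charlierPoly_succ_eval_succ, charlierPoly_eval_comm θ (x + 1),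
    charlierPoly_eval_comm θ x]

/-- The three-term recurrence, at integer points. -/
theorem charlierPoly_recurrence {θ : ℝ} (hθ : θ ≠ 0) (m x : ℕ) :
    θ * (charlierPoly θ (m + 2)).eval (x : ℝ) =
      (θ + (m + 1) - x) * (charlierPoly θ (m + 1)).eval (x : ℝ) -
        (m + 1) * (charlierPoly θ m).eval (x : ℝ) := by
  cases x with
  | zero => simp
  | succ n =>
    -- The difference relations express every term through `C_{m+1}(n+1)` and `C_m(n)`.
    have h1 := charlierPoly_succ_eval_succ' θ (m + 1) n
    have h2 := charlierPoly_succ_eval_succ' θ m n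
    have h3 := charlierPoly_succ_eval_succ θ m n
    rw [h1, mul_sub, show θ * ((n + 1) / θ * (charlierPoly θ (m + 1)).eval (n : ℝ)) =
      (n + 1) * (charlierPoly θ (m + 1)).eval (n : ℝ) by field_simp]
    have h4 : (charlierPoly θ (m + 1)).eval (n : ℝ) =
      (charlierPoly θ (m + 1)).eval ((n + 1 : ℕ) : ℝ) +
        (m + 1) / θ * (charlierPoly θ m).eval (n : ℝ) := by rw [h3]; ring
    have h5 : (charlierPoly θ m).eval ((n + 1 : ℕ) : ℝ) =
      (charlierPoly θ (m + 1)).eval ((n + 1 : ℕ) : ℝ) +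
        (n + 1) / θ * (charlierPoly θ m).eval (n : ℝ) := by rw [h2]; ring
    rw [h4, h5]
    push_cast
    ring

theorem charlierPoly_one_eval {θ : ℝ} (hθ : θ ≠ 0) (x : ℝ) :
    θ * (charlierPoly θ 1).eval x = θ - x := by
  simp [charlierPoly, Finset.sum_range_succ]
  field_simp
  ring

/-! ### Orthogonality -/

theorem summable_charlierWeight_mul_charlierPoly (θ : ℝ) (m n : ℕ) :
    Summable fun z : ℕ => charlierWeight θ z *
      ((charlierPoly θ m).eval (z : ℝ) * (charlierPoly θ n).eval (z : ℝ)) := by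
  simpa using summable_charlierWeight_mul_eval θ (charlierPoly θ m * charlierPoly θ n)

theorem charlierWeight_succ (θ : ℝ) (z : ℕ) :
    charlierWeight θ (z + 1) * (z + 1) = θ * charlierWeight θ z := by
  rw [charlierWeight, charlierWeight, Nat.factorial_succ, pow_succ]
  push_cast
  field_simp

/-- Summation by parts: raising the degree is adjoint, under the weight, to minus the forward
difference. Keeping that difference as `-d * g` covers `n = 0` and `n ≥ 1` together. -/
theorem tsum_charlierWeight_mul_charlierPoly_succ {θ : ℝ} (hθ : θ ≠ 0) (m n : ℕ)
    (d : ℝ) (g : ℕ → ℝ)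
    (hg : ∀ z : ℕ, (charlierPoly θ n).eval ((z + 1 : ℕ) : ℝ) =
      (charlierPoly θ n).eval (z : ℝ) - d * g z)
    (hs : Summable fun z : ℕ => charlierWeight θ z * ((charlierPoly θ m).eval (z : ℝ) * g z)) :
    ∑' z : ℕ, charlierWeight θ z *
        ((charlierPoly θ (m + 1)).eval (z : ℝ) * (charlierPoly θ n).eval (z : ℝ)) =
      d * ∑' z : ℕ, charlierWeight θ z * ((charlierPoly θ m).eval (z : ℝ) * g z) := by
  have s1 := summable_charlierWeight_mul_charlierPoly θ (m + 1) n
  have s0 := summable_charlierWeight_mul_charlierPoly θ m n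
  -- The term at `z = 0` vanishes because both polynomials equal `1` there.
  have hF := (s1.sub s0).tsum_eq_zero_add
  rw [s1.tsum_sub s0] at hF
  have hstep : ∀ z : ℕ, charlierWeight θ (z + 1) *
        ((charlierPoly θ (m + 1)).eval ((z + 1 : ℕ) : ℝ) *
          (charlierPoly θ n).eval ((z + 1 : ℕ) : ℝ)) -
      charlierWeight θ (z + 1) * ((charlierPoly θ m).eval ((z + 1 : ℕ) : ℝ) *
          (charlierPoly θ n).eval ((z + 1 : ℕ) : ℝ)) =
      d * (charlierWeight θ z * ((charlierPoly θ m).eval (z : ℝ) * g z)) -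
      charlierWeight θ z *
        ((charlierPoly θ m).eval (z : ℝ) * (charlierPoly θ n).eval (z : ℝ)) := by
    intro z
    have hW : charlierWeight θ (z + 1) * ((z + 1) / θ) = charlierWeight θ z := by
      have := charlierWeight_succ θ z
      field_simp
      linarith
    rw [charlierPoly_succ_eval_succ' θ m z, hg z]
    linear_combination (-(charlierPoly θ m).eval (z : ℝ) *
      ((charlierPoly θ n).eval (z : ℝ) - d * g z)) * hW
  simp only [hstep] at hF
  rw [(hs.mul_left d).tsum_sub s0, tsum_mul_left] at hF
  simp only [Nat.cast_zero, charlierPoly_eval_zero] at hF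
  linarith

theorem tsum_charlierWeight_mul_charlierPoly {θ : ℝ} (hθ : θ ≠ 0) (m n : ℕ) :
    ∑' z : ℕ, charlierWeight θ z *
        ((charlierPoly θ m).eval (z : ℝ) * (charlierPoly θ n).eval (z : ℝ)) =
      if m = n then Real.exp θ * n.factorial / θ ^ n else 0 := by
  have hzero : ∀ m : ℕ, ∑' z : ℕ, charlierWeight θ z *
      ((charlierPoly θ (m + 1)).eval (z : ℝ) * (charlierPoly θ 0).eval (z : ℝ)) = 0 := fun m => by
    rw [tsum_charlierWeight_mul_charlierPoly_succ hθ m 0 0 (fun _ => 0) (by simp) (by simp),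
      zero_mul]
  induction m generalizing n with
  | zero =>
    cases n with
    | zero =>
      simp only [charlierPoly_zero_eval, charlierWeight]
      rw [Real.exp_eq_exp_ℝ, NormedSpace.exp_eq_tsum_div]
      simp
    | succ n => simpa [mul_comm] using hzero n
  | succ m ih =>
    cases n with
    | zero => simpa using hzero m
    | succ n =>
      rw [tsum_charlierWeight_mul_charlierPoly_succ hθ m (n + 1) ((n + 1) / θ)
        (fun z => (charlierPoly θ n).eval (z : ℝ)) (charlierPoly_succ_eval_succ θ n)
        (summable_charlierWeight_mul_charlierPoly θ m n), ih n]
      simp only [Nat.add_right_cancel_iff]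
      split_ifs
      · rw [Nat.factorial_succ, pow_succ]
        push_cast
        field_simp
      · simp

theorem tsum_charlierWeight_mul_charlierPoly_sq {θ : ℝ} (hθ : θ ≠ 0) (n : ℕ) :
    ∑' z : ℕ, charlierWeight θ z * (charlierPoly θ n).eval (z : ℝ) ^ 2 =
      Real.exp θ * n.factorial / θ ^ n := by
  simpa [sq] using tsum_charlierWeight_mul_charlierPoly hθ n n

/-! ### Kernels of orthogonal projections -/

/-- Bessel's inequality makes the kernel of a finite orthonormal family a contraction. -/
theorem isContractionKernel_sum_mul {α ι : Type*} [DecidableEq ι] (s : Finset ι) (φ : ι → α → ℝ)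
    (hφ : ∀ m ∈ s, ∀ n ∈ s, HasSum (fun z => φ m z * φ n z) (if m = n then 1 else 0)) :
    IsContractionKernel fun x y => ∑ n ∈ s, φ n x * φ n y := by
  have hform : ∀ (Y : Finset α) (v : α → ℝ),
      ∑ x ∈ Y, ∑ y ∈ Y, v x * (∑ n ∈ s, φ n x * φ n y) * v y =
        ∑ n ∈ s, (∑ x ∈ Y, v x * φ n x) ^ 2 := by
    intro Y v
    simp only [sq, Finset.sum_mul_sum]
    rw [Finset.sum_comm (s := s)]
    refine Finset.sum_congr rfl fun x _ => ?_
    rw [Finset.sum_comm (s := s)]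
    refine Finset.sum_congr rfl fun y _ => ?_
    rw [Finset.mul_sum, Finset.sum_mul]
    exact Finset.sum_congr rfl fun n _ => by ring
  refine ⟨fun x y => Finset.sum_congr rfl fun n _ => mul_comm _ _, fun Y v => ?_, fun Y v => ?_⟩
  · rw [hform]
    positivity
  · rw [hform]
    classical
    let a : ι → ℝ := fun n => ∑ x ∈ Y, v x * φ n x
    let u : α → ℝ := fun x => if x ∈ Y then v x else 0
    have h1 : HasSum (fun z => u z ^ 2) (∑ x ∈ Y, v x ^ 2) := by
      have := hasSum_sum_of_ne_finset_zero (f := fun z => u z ^ 2) (s := Y) (L := .unconditional α)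
        fun z hz => by simp [u, hz]
      rwa [Finset.sum_congr rfl fun x hx => by
        show u x ^ 2 = v x ^ 2
        simp [u, hx]] at this
    have h2 : HasSum (fun z => ∑ n ∈ s, a n * (u z * φ n z)) (∑ n ∈ s, a n * a n) := by
      refine hasSum_sum fun n _ => HasSum.mul_left _ ?_
      have := hasSum_sum_of_ne_finset_zero (f := fun z => u z * φ n z) (s := Y) (L := .unconditional α)
        fun z hz => by simp [u, hz]
      rwa [Finset.sum_congr rfl fun x hx => by
        show u x * φ n x = v x * φ n x
        simp [u, hx]] at this
    have h3 : HasSum (fun z => ∑ m ∈ s, ∑ n ∈ s, a m * a n * (φ m z * φ n z))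
        (∑ m ∈ s, ∑ n ∈ s, a m * a n * (if m = n then 1 else 0)) :=
      hasSum_sum fun m hm => hasSum_sum fun n hn => (hφ m hm n hn).mul_left _
    have h4 : ∑ m ∈ s, ∑ n ∈ s, a m * a n * (if m = n then 1 else 0) = ∑ n ∈ s, a n * a n :=
      Finset.sum_congr rfl fun m hm => by simp [hm]
    rw [h4] at h3
    -- The termwise sum is `‖u - ∑ a n • φ n‖²`, whose nonnegativity is Bessel's inequality.
    have h5 := ((h1.sub (h2.mul_left 2)).add h3).nonneg fun z => by
      have hz : ∑ m ∈ s, ∑ n ∈ s, a m * a n * (φ m z * φ n z) = (∑ n ∈ s, a n * φ n z) ^ 2 := by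
        rw [sq, Finset.sum_mul_sum]
        exact Finset.sum_congr rfl fun m _ => Finset.sum_congr rfl fun n _ => by ring
      have hz' : ∑ n ∈ s, a n * (u z * φ n z) = u z * ∑ n ∈ s, a n * φ n z := by
        rw [Finset.mul_sum]
        exact Finset.sum_congr rfl fun n _ => by ring
      rw [hz, hz']
      nlinarith [sq_nonneg (u z - ∑ n ∈ s, a n * φ n z)]
    have h6 : ∑ n ∈ s, (∑ x ∈ Y, v x * φ n x) ^ 2 = ∑ n ∈ s, a n * a n :=
      Finset.sum_congr rfl fun n _ => sq _
    linarith

theorem isContractionKernel_charlier {θ : ℝ} (hθ : 0 < θ) (N : ℕ) :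
    IsContractionKernel
      (orthogonalPolynomialKernel (charlierWeight θ) (charlierPoly θ) N) := by
  have hW : ∀ x, 0 ≤ charlierWeight θ x := fun x => by unfold charlierWeight; positivity
  let c : ℕ → ℝ := fun n => Real.exp θ * n.factorial / θ ^ n
  have hc : ∀ n, 0 < c n := fun n => by positivity
  have h := isContractionKernel_sum_mul (Finset.range N)
    (fun n (x : ℕ) => (√(c n))⁻¹ * (√(charlierWeight θ x) * (charlierPoly θ n).eval (x : ℝ)))
    (fun m _ n _ => by
      have h1 := (summable_charlierWeight_mul_charlierPoly θ m n).hasSum.mul_left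
        ((√(c m))⁻¹ * (√(c n))⁻¹)
      rw [tsum_charlierWeight_mul_charlierPoly hθ.ne'] at h1
      convert! h1 using 1
      · funext z
        have := Real.mul_self_sqrt (hW z)
        linear_combination ((√(c m))⁻¹ * (√(c n))⁻¹ * (charlierPoly θ m).eval (z : ℝ) *
          (charlierPoly θ n).eval (z : ℝ)) * this
      · split_ifs with hmn
        · subst hmn
          change 1 = _ * c m
          rw [← mul_inv, Real.mul_self_sqrt (hc m).le, inv_mul_cancel₀ (hc m).ne']
        · simp)
  convert h using 1
  ext x y
  rw [orthogonalPolynomialKernel, Real.sqrt_mul (hW x), Finset.mul_sum]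
  refine Finset.sum_congr rfl fun n _ => ?_
  rw [tsum_charlierWeight_mul_charlierPoly_sq hθ.ne']
  rw [show Real.exp θ * n.factorial / θ ^ n = c n from rfl]
  have : (√(c n))⁻¹ * (√(c n))⁻¹ = (c n)⁻¹ := by rw [← mul_inv, Real.mul_self_sqrt (hc n).le]
  rw [div_eq_mul_inv, ← this]
  ring

/-- By self-duality, the kernel is a sum over the Poisson distribution of Charlier polynomials
of fixed degree. -/
theorem orthogonalPolynomialKernel_charlier_eq {θ : ℝ} (hθ : 0 < θ) (N x y : ℕ) :
    orthogonalPolynomialKernel (charlierWeight θ) (charlierPoly θ) N x y =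
      √(charlierWeight θ x * charlierWeight θ y) * ∑ n ∈ Finset.range N,
        (Real.exp (-θ) * θ ^ n / n.factorial) *
          ((charlierPoly θ x).eval (n : ℝ) * (charlierPoly θ y).eval (n : ℝ)) := by
  rw [orthogonalPolynomialKernel]
  congr 1
  refine Finset.sum_congr rfl fun n _ => ?_
  rw [tsum_charlierWeight_mul_charlierPoly_sq hθ.ne', charlierPoly_eval_comm θ n x,
    charlierPoly_eval_comm θ n y, Real.exp_neg]
  field_simp

/-! ### Convergence of integrals of unbounded functions over half-lines -/

/-- The truncated `f` and its continuous surrogate `g` differ only on `A`, by at most `2|f| ≤ δ f² +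
1/δ`. Since `A` has mass at most `δ²`, the second-moment bound suffices. -/
theorem abs_setIntegral_Ioi_sub_integral_le {ν : Measure ℝ} [IsProbabilityMeasure ν] {f g : ℝ → ℝ}
    (hf : Continuous f) (hg : Continuous g) {B : ℝ} (hint : Integrable (fun s => f s ^ 2) ν)
    (hB : ∫ s, f s ^ 2 ∂ν ≤ B) {A : Set ℝ} (hA : MeasurableSet A) {δ ρ : ℝ} (hδ : 0 < δ)
    (hνA : ν.real A ≤ δ ^ 2) (hfg : ∀ s, |g s| ≤ |f s|)
    (heq : ∀ s, s ∉ A → (Set.Ioi ρ).indicator f s = g s) :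
    |(∫ s in Set.Ioi ρ, f s ∂ν) - ∫ s, g s ∂ν| ≤ δ * (B + 1) := by
  have hfi : Integrable f ν := by
    refine (hint.add (integrable_const 1)).mono' hf.aestronglyMeasurable (ae_of_all _ fun s => ?_)
    change |f s| ≤ f s ^ 2 + 1
    nlinarith [sq_abs (f s), sq_nonneg (|f s| - 1), abs_nonneg (f s)]
  have hgi : Integrable g ν := hfi.mono hg.aestronglyMeasurable (ae_of_all _ hfg)
  have hind : Integrable (fun s => A.indicator (fun _ => (1 : ℝ)) s) ν :=
    (integrable_const 1).indicator hA
  rw [← integral_indicator measurableSet_Ioi,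
    ← integral_sub (hfi.indicator measurableSet_Ioi) hgi]
  calc |∫ s, ((Set.Ioi ρ).indicator f s - g s) ∂ν|
      ≤ ∫ s, |(Set.Ioi ρ).indicator f s - g s| ∂ν := abs_integral_le_integral_abs
    _ ≤ ∫ s, (δ * f s ^ 2 + δ⁻¹ * A.indicator (fun _ => (1 : ℝ)) s) ∂ν := by
        refine integral_mono ((hfi.indicator measurableSet_Ioi).sub hgi).abs
          ((hint.const_mul δ).add (hind.const_mul _)) fun s => ?_
        by_cases hs : s ∈ A
        · have h1 : |(Set.Ioi ρ).indicator f s| ≤ |f s| := by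
            rw [Set.indicator_apply]
            split_ifs <;> simp
          have h2 : |(Set.Ioi ρ).indicator f s - g s| ≤ 2 * |f s| := by
            have := abs_sub ((Set.Ioi ρ).indicator f s) (g s)
            linarith [hfg s]
          have h3 : 2 * |f s| ≤ δ * f s ^ 2 + δ⁻¹ := by
            rw [← sq_abs (f s)]
            have : 0 ≤ δ * (|f s| - δ⁻¹) ^ 2 := by positivity
            have h4 : δ * (|f s| - δ⁻¹) ^ 2 = δ * |f s| ^ 2 - 2 * |f s| + δ⁻¹ := by
              field_simp
              ring
            linarith
          simpa [hs] using h2.trans h3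
        · simp only [heq s hs, sub_self, abs_zero, hs, not_false_eq_true,
            Set.indicator_of_notMem, mul_zero, add_zero]
          positivity
    _ = δ * ∫ s, f s ^ 2 ∂ν + δ⁻¹ * ν.real A := by
        rw [integral_add (hint.const_mul δ) (hind.const_mul _), integral_const_mul,
          integral_const_mul]
        congr 2
        exact integral_indicator_one hA
    _ ≤ δ * B + δ⁻¹ * δ ^ 2 := by gcongr
    _ = δ * (B + 1) := by field_simp

/-- Weak convergence misses only the jump near `r` and the growth at infinity. Both lie in a closed
set of small limiting mass, as `r` is not an atom, and the portmanteau theorem transfers this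
smallness to `μs N`. -/
theorem tendsto_setIntegral_Ioi {μs : ℕ → ProbabilityMeasure ℝ} {μ : ProbabilityMeasure ℝ}
    (h : Tendsto μs atTop (𝓝 μ)) [NullSingletonClass (μ : Measure ℝ)] {f : ℝ → ℝ} (hf : Continuous f) {B : ℝ}
    (hB : ∀ᶠ N in atTop, Integrable (fun s => f s ^ 2) (μs N : Measure ℝ) ∧
      ∫ s, f s ^ 2 ∂(μs N : Measure ℝ) ≤ B)
    (hμ : Integrable (fun s => f s ^ 2) (μ : Measure ℝ)) (hμB : ∫ s, f s ^ 2 ∂(μ : Measure ℝ) ≤ B)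
    {rs : ℕ → ℝ} {r : ℝ} (hr : Tendsto rs atTop (𝓝 r)) :
    Tendsto (fun N => ∫ s in Set.Ioi (rs N), f s ∂(μs N : Measure ℝ)) atTop
      (𝓝 (∫ s in Set.Ioi r, f s ∂(μ : Measure ℝ))) := by
  have hB0 : 0 ≤ B := (integral_nonneg fun s => sq_nonneg _).trans hμB
  rw [Metric.tendsto_atTop']
  intro η hη
  -- Two surrogate errors, one for each measure, and the weak-convergence error for `g`.
  obtain ⟨δ, hδ, hδη⟩ : ∃ δ : ℝ, 0 < δ ∧ δ * (B + 1) + δ + δ * (B + 1) = η :=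
    ⟨η / (2 * B + 3), by positivity, by field_simp; ring⟩
  let A : ℕ → Set ℝ := fun n => {s | |s - r| ≤ 1 / ((n : ℝ) + 1)} ∪ {s | (n : ℝ) ≤ |s|}
  have hAclosed : ∀ n, IsClosed (A n) := fun n =>
    (isClosed_le (by fun_prop) (by fun_prop)).union (isClosed_le (by fun_prop) (by fun_prop))
  have hAanti : Antitone A := by
    intro m n hmn s hs
    have hmn' : (m : ℝ) ≤ n := Nat.cast_le.mpr hmn
    rcases hs with hs | hs
    · have hs' : |s - r| ≤ 1 / ((n : ℝ) + 1) := hs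
      exact Or.inl (hs'.trans (one_div_le_one_div_of_le (by positivity) (by linarith)))
    · exact Or.inr (hmn'.trans hs)
  have hAinter : ⋂ n, A n ⊆ {r} := by
    intro s hs
    rw [Set.mem_iInter] at hs
    by_contra hsr
    have hpos : 0 < |s - r| := abs_pos.mpr (sub_ne_zero.mpr hsr)
    obtain ⟨n, hn⟩ := exists_nat_one_div_lt hpos
    obtain ⟨m, hm⟩ := exists_nat_gt |s|
    rcases hAanti (le_max_left n m) (hs (max n m)) with h1 | h1
    · exact absurd h1 (not_le.mpr hn)
    · rcases hs (max n m) with h2 | h2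
      · refine absurd (h2.trans ?_) (not_le.mpr hn)
        gcongr
        exact le_max_left n m
      · have : (m : ℝ) ≤ (max n m : ℕ) := Nat.cast_le.mpr (le_max_right n m)
        exact absurd (this.trans h2) (not_le.mpr hm)
  have hAlim : Tendsto (fun n => (μ : Measure ℝ) (A n)) atTop (𝓝 0) := by
    have := tendsto_measure_iInter_atTop (μ := (μ : Measure ℝ))
      (fun n => (hAclosed n).measurableSet.nullMeasurableSet) hAanti ⟨0, measure_ne_top _ _⟩
    rwa [measure_mono_null hAinter (measure_singleton r)] at this
  have hδ2 : (0 : ENNReal) < ENNReal.ofReal (δ ^ 2) := ENNReal.ofReal_pos.mpr (by positivity)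
  obtain ⟨n, hn⟩ := (hAlim.eventually_lt_const hδ2).exists
  have hνA : ∀ᶠ N in atTop, (μs N : Measure ℝ) (A n) < ENNReal.ofReal (δ ^ 2) :=
    eventually_lt_of_limsup_lt
      ((ProbabilityMeasure.limsup_measure_closed_le_of_tendsto h (hAclosed n)).trans_lt hn)
  have hreal : ∀ ν : ProbabilityMeasure ℝ, (ν : Measure ℝ) (A n) < ENNReal.ofReal (δ ^ 2) →
      (ν : Measure ℝ).real (A n) ≤ δ ^ 2 := fun ν hν =>
    ENNReal.toReal_le_of_le_ofReal (by positivity) hν.le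
  let ε : ℝ := 1 / ((n : ℝ) + 1)
  have hε : 0 < ε := by positivity
  -- The ramp rises inside the excluded neighbourhood of `r`, so one `g` serves every cutoff within
  -- `ε` of `r`.
  let φ : ℝ → ℝ := fun s => max 0 (min 1 ((s - r) / ε))
  let ψ : ℝ → ℝ := fun s => max 0 (min 1 ((n : ℝ) + 1 - |s|))
  have hφ : ∀ s, 0 ≤ φ s ∧ φ s ≤ 1 := fun s => ⟨le_max_left _ _, by simp [φ]⟩
  have hψ : ∀ s, 0 ≤ ψ s ∧ ψ s ≤ 1 := fun s => ⟨le_max_left _ _, by simp [ψ]⟩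
  let g : ℝ → ℝ := fun s => f s * φ s * ψ s
  have hgc : Continuous g := by
    have hφc : Continuous φ := by fun_prop
    have hψc : Continuous ψ := by fun_prop
    fun_prop
  have hgsupp : HasCompactSupport g := by
    refine HasCompactSupport.intro (isCompact_Icc (a := -((n : ℝ) + 1)) (b := n + 1)) fun s hs => ?_
    have : (n : ℝ) + 1 - |s| ≤ 0 := by
      have := mt abs_le.mp hs
      linarith [not_le.mp this]
    simp [g, ψ, this]
  obtain ⟨C, hC⟩ := hgsupp.exists_bound_of_continuous hgc
  have hgle : ∀ s, |g s| ≤ |f s| := by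
    intro s
    have h1 : φ s * ψ s ≤ 1 := mul_le_one₀ (hφ s).2 (hψ s).1 (hψ s).2
    have h2 : 0 ≤ φ s * ψ s := mul_nonneg (hφ s).1 (hψ s).1
    change |f s * φ s * ψ s| ≤ _
    rw [mul_assoc, abs_mul, abs_of_nonneg h2]
    exact mul_le_of_le_one_right (abs_nonneg _) h1
  have heq : ∀ ρ, |ρ - r| < ε → ∀ s, s ∉ A n → (Set.Ioi ρ).indicator f s = g s := by
    intro ρ hρ s hs
    have hs' : ¬ (|s - r| ≤ ε) ∧ ¬ ((n : ℝ) ≤ |s|) := not_or.mp hs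
    obtain ⟨h1, h2⟩ := hs'
    rw [not_le] at h1 h2
    rw [abs_lt] at hρ
    have hψ1 : ψ s = 1 := by
      have : (1 : ℝ) ≤ n + 1 - |s| := by linarith
      simp [ψ, this]
    rcases lt_abs.mp h1 with h3 | h3
    · have : φ s = 1 := by
        have : 1 ≤ (s - r) / ε := (one_le_div hε).mpr h3.le
        simp [φ, this]
      rw [Set.indicator_of_mem (by rw [Set.mem_Ioi]; linarith)]
      simp [g, this, hψ1]
    · have : φ s = 0 := by
        have : (s - r) / ε ≤ 0 := div_nonpos_of_nonpos_of_nonneg (by linarith) hε.le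
        simp [φ, this]
      rw [Set.indicator_of_notMem (by rw [Set.mem_Ioi]; linarith)]
      simp [g, this]
  have hglim := (ProbabilityMeasure.tendsto_iff_forall_integral_tendsto.mp h
    (BoundedContinuousFunction.ofNormedAddCommGroup g hgc C hC))
  have hμg := abs_setIntegral_Ioi_sub_integral_le hf hgc hμ hμB (hAclosed n).measurableSet hδ
    (hreal μ hn) hgle (heq r (by simpa using hε))
  have hev : ∀ᶠ N in atTop, dist (∫ s in Set.Ioi (rs N), f s ∂(μs N : Measure ℝ))
      (∫ s in Set.Ioi r, f s ∂(μ : Measure ℝ)) < η := by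
    filter_upwards [hB, hνA, (Metric.tendsto_nhds.mp hr) ε hε, (Metric.tendsto_nhds.mp hglim) δ hδ]
      with N h1 h2 h3 h4
    have hNg := abs_setIntegral_Ioi_sub_integral_le hf hgc h1.1 h1.2 (hAclosed n).measurableSet hδ
      (hreal _ h2) hgle (heq (rs N) h3)
    change |(∫ s, g s ∂(μs N : Measure ℝ)) - ∫ s, g s ∂(μ : Measure ℝ)| < δ at h4
    rw [Real.dist_eq, ← hδη]
    rw [abs_le] at hNg hμg
    rw [abs_lt] at h4 ⊢
    constructor <;> linarith
  obtain ⟨N, hN⟩ := eventually_atTop.mp hev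
  exact ⟨N, fun m hm => hN m hm.le⟩

/-! ### Moments -/

/-- `∫ exp s` and `∫ exp (-s)` are finite and at most `B`. -/
structure HasExpMomentBound (μ : Measure ℝ) (B : ℝ) : Prop where
  integrable : Integrable (fun s => Real.exp s) μ
  integrable_neg : Integrable (fun s => Real.exp (-s)) μ
  le : ∫ s, Real.exp s ∂μ ≤ B
  le_neg : ∫ s, Real.exp (-s) ∂μ ≤ B

theorem abs_pow_le_factorial_mul_exp_add_exp (k : ℕ) (s : ℝ) :
    |s ^ k| ≤ k.factorial * (Real.exp s + Real.exp (-s)) := by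
  have h1 := Real.pow_div_factorial_le_exp |s| (abs_nonneg s) k
  rw [div_le_iff₀ (by positivity)] at h1
  have h2 : Real.exp |s| ≤ Real.exp s + Real.exp (-s) := by
    rcases abs_choice s with h | h <;> rw [h] <;> linarith [Real.exp_pos s, Real.exp_pos (-s)]
  rw [abs_pow]
  nlinarith [Nat.cast_nonneg (α := ℝ) k.factorial]

theorem HasExpMomentBound.integrable_pow {μ : Measure ℝ} {B : ℝ} (h : HasExpMomentBound μ B)
    (k : ℕ) : Integrable (fun s => s ^ k) μ :=
  ((h.integrable.add h.integrable_neg).const_mul (k.factorial : ℝ)).mono'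
    (by fun_prop) (ae_of_all _ fun s => abs_pow_le_factorial_mul_exp_add_exp k s)

theorem HasExpMomentBound.integral_pow_le {μ : Measure ℝ} {B : ℝ} (h : HasExpMomentBound μ B)
    (k : ℕ) : ∫ s, s ^ k ∂μ ≤ k.factorial * (B + B) := by
  calc ∫ s, s ^ k ∂μ ≤ ∫ s, k.factorial * (Real.exp s + Real.exp (-s)) ∂μ :=
        integral_mono (h.integrable_pow k) ((h.integrable.add h.integrable_neg).const_mul _)
          fun s => (le_abs_self _).trans (abs_pow_le_factorial_mul_exp_add_exp k s)
    _ = k.factorial * ((∫ s, Real.exp s ∂μ) + ∫ s, Real.exp (-s) ∂μ) := by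
        rw [integral_const_mul, integral_add h.integrable h.integrable_neg]
    _ ≤ _ := by
        have := h.le
        have := h.le_neg
        gcongr

theorem HasExpMomentBound.setIntegral_eval {μ : Measure ℝ} {B : ℝ} (h : HasExpMomentBound μ B)
    {p : Polynomial ℝ} {d : ℕ} (hp : p.natDegree ≤ d) (S : Set ℝ) :
    ∫ s in S, p.eval s ∂μ = ∑ k ∈ Finset.range (d + 1), p.coeff k * ∫ s in S, s ^ k ∂μ := by
  simp only [Polynomial.eval_eq_sum_range' (Nat.lt_succ_of_le hp)]
  rw [integral_finsetSum _ fun k _ => ((h.integrable_pow k).const_mul _).integrableOn]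
  exact Finset.sum_congr rfl fun k _ => integral_const_mul _ _

/-- The common degree bound reduces this to finitely many monomials; the square of `s ^ k` is
controlled by the moment of order `2k`. -/
theorem tendsto_setIntegral_Ioi_eval {μs : ℕ → ProbabilityMeasure ℝ} {μ : ProbabilityMeasure ℝ}
    (h : Tendsto μs atTop (𝓝 μ)) [NullSingletonClass (μ : Measure ℝ)] {B : ℝ}
    (hB : ∀ᶠ N in atTop, HasExpMomentBound (μs N : Measure ℝ) B)
    (hμ : HasExpMomentBound (μ : Measure ℝ) B)
    {rs : ℕ → ℝ} {r : ℝ} (hr : Tendsto rs atTop (𝓝 r))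
    {ps : ℕ → Polynomial ℝ} {p : Polynomial ℝ} {d : ℕ} (hps : ∀ N, (ps N).natDegree ≤ d)
    (hp : p.natDegree ≤ d) (hcoeff : ∀ k, Tendsto (fun N => (ps N).coeff k) atTop (𝓝 (p.coeff k))) :
    Tendsto (fun N => ∫ s in Set.Ioi (rs N), (ps N).eval s ∂(μs N : Measure ℝ)) atTop
      (𝓝 (∫ s in Set.Ioi r, p.eval s ∂(μ : Measure ℝ))) := by
  rw [hμ.setIntegral_eval hp]
  have hlim : Tendsto (fun N => ∑ k ∈ Finset.range (d + 1),
      (ps N).coeff k * ∫ s in Set.Ioi (rs N), s ^ k ∂(μs N : Measure ℝ)) atTop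
      (𝓝 (∑ k ∈ Finset.range (d + 1),
        p.coeff k * ∫ s in Set.Ioi r, s ^ k ∂(μ : Measure ℝ))) := by
    refine tendsto_finsetSum _ fun k _ => (hcoeff k).mul ?_
    refine tendsto_setIntegral_Ioi h (by fun_prop) (B := (k * 2).factorial * (B + B)) ?_ ?_ ?_ hr
    · filter_upwards [hB] with N hN
      simp only [← pow_mul]
      exact ⟨hN.integrable_pow _, hN.integral_pow_le _⟩
    · simpa only [← pow_mul] using hμ.integrable_pow (k * 2)
    · simpa only [← pow_mul] using hμ.integral_pow_le (k * 2)
  refine hlim.congr' ?_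
  filter_upwards [hB] with N hN
  exact (hN.setIntegral_eval (hps N) _).symm

/-! ### The Poisson distribution and its Gaussian limit -/

open ProbabilityTheory in
/-- The law of `(θ - n) / √(2 θ)` when `n` has the Poisson distribution with parameter `θ`. -/
def scaledPoisson (θ : NNReal) : ProbabilityMeasure ℝ :=
  ⟨(poissonMeasure θ).map fun n : ℕ => ((θ : ℝ) - n) / √(2 * θ),
    Measure.isProbabilityMeasure_map .of_discrete⟩

open ProbabilityTheory in
theorem coe_scaledPoisson (θ : NNReal) : (scaledPoisson θ : Measure ℝ) =
    (poissonMeasure θ).map fun n : ℕ => ((θ : ℝ) - n) / √(2 * θ) := rfl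

theorem charFun_scaledPoisson (θ : NNReal) (t : ℝ) :
    charFun (scaledPoisson θ : Measure ℝ) t =
      Complex.exp (θ * (Complex.exp ((-(t / √(2 * θ)) : ℝ) * Complex.I) - 1 -
        (-(t / √(2 * θ)) : ℝ) * Complex.I)) := by
  have h := ProbabilityTheory.charFun_map_cast_poissonMeasure θ (-(t / √(2 * θ)))
  rw [charFun_apply, integral_map .of_discrete (by fun_prop)] at h
  rw [coe_scaledPoisson, charFun_apply, integral_map .of_discrete (by fun_prop)]
  have h2 : ∀ n : ℕ, Complex.exp ((inner ℝ (((θ : ℝ) - n) / √(2 * θ)) t : ℝ) * Complex.I) =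
      Complex.exp ((inner ℝ (n : ℝ) (-(t / √(2 * θ))) : ℝ) * Complex.I) *
        Complex.exp (θ * (t / √(2 * θ) : ℝ) * Complex.I) := by
    intro n
    rw [← Complex.exp_add]
    congr 1
    simp only [RCLike.inner_apply, conj_trivial]
    push_cast
    ring
  simp only [h2]
  rw [integral_mul_const, h, ← Complex.exp_add]
  congr 1
  push_cast
  ring

open ProbabilityTheory in
/-- The centred normal distribution with variance `1 / 2`. -/
def gaussianHalf : ProbabilityMeasure ℝ := ⟨gaussianReal 0 (1 / 2), inferInstance⟩

open ProbabilityTheory in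
theorem coe_gaussianHalf : (gaussianHalf : Measure ℝ) = gaussianReal 0 (1 / 2) := rfl

instance : NullSingletonClass (gaussianHalf : Measure ℝ) :=
  ProbabilityTheory.nullSingletonClass_gaussianReal (by norm_num)

open ProbabilityTheory in
-- Lévy continuity. The exponent is `θ (e^z - 1 - z)` with `z = -it / √(2θ)`: its quadratic part is
-- exactly `-t²/4`, and the cubic remainder is of order `θ^{-1/2}`.
theorem tendsto_scaledPoisson {θ : ℕ → NNReal} (hθ : Tendsto θ atTop atTop) :
    Tendsto (fun N => scaledPoisson (θ N)) atTop (𝓝 gaussianHalf) := by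
  apply ProbabilityMeasure.tendsto_of_tendsto_charFun
  intro t
  simp only [charFun_scaledPoisson]
  rw [coe_gaussianHalf, charFun_gaussianReal]
  refine (Complex.continuous_exp.tendsto _).comp ?_
  have hθ' : Tendsto (fun N => (θ N : ℝ)) atTop atTop :=
    NNReal.tendsto_coe_atTop.mpr hθ
  have hσ : Tendsto (fun N => √(2 * (θ N : ℝ))) atTop atTop :=
    Real.tendsto_sqrt_atTop.comp (hθ'.const_mul_atTop (by norm_num))
  have hu : Tendsto (fun N => |t| / √(2 * (θ N : ℝ))) atTop (𝓝 0) := hσ.const_div_atTop _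
  have hbound : Tendsto (fun N => t ^ 2 / 2 * (|t| / √(2 * (θ N : ℝ)) *
      Real.exp (|t| / √(2 * (θ N : ℝ))))) atTop (𝓝 0) := by
    have := (hu.mul ((Real.continuous_exp.tendsto 0).comp hu)).const_mul (t ^ 2 / 2)
    simpa using this
  rw [tendsto_iff_norm_sub_tendsto_zero]
  refine squeeze_zero' (Eventually.of_forall fun N => norm_nonneg _) ?_ hbound
  filter_upwards [hθ'.eventually_gt_atTop 0] with N hN
  set σ := √(2 * (θ N : ℝ)) with hσdef
  have hσpos : 0 < σ := Real.sqrt_pos.mpr (by positivity)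
  have hσ2 : σ ^ 2 = 2 * θ N := Real.sq_sqrt (by positivity)
  set z : ℂ := (-(t / σ) : ℝ) * Complex.I with hz
  have hznorm : ‖z‖ = |t| / σ := by
    rw [hz, norm_mul, Complex.norm_I, mul_one, Complex.norm_real, norm_neg, norm_div,
      Real.norm_eq_abs, Real.norm_eq_abs, abs_of_pos hσpos]
  have hz2 : (θ N : ℂ) * (z ^ 2 / 2) = -(t ^ 2 / 4 : ℝ) := by
    have : (θ N : ℝ) * ((t / σ) ^ 2 / 2) = t ^ 2 / 4 := by
      rw [div_pow, hσ2]
      field_simp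
      norm_num
    rw [← this, hz, mul_pow, Complex.I_sq]
    push_cast
    ring
  clear_value z
  have key := Complex.norm_exp_sub_sum_le_norm_mul_exp z 3
  have hrew : (θ N : ℂ) * (Complex.exp z - 1 - z) -
      ((t : ℂ) * ((0 : ℝ) : ℂ) * Complex.I - ((1 / 2 : NNReal) : ℂ) * (t : ℂ) ^ 2 / 2) =
      θ N * (Complex.exp z - ∑ m ∈ Finset.range 3, z ^ m / m.factorial) := by
    have : ((1 / 2 : NNReal) : ℂ) = 1 / 2 := by
      simp
    rw [this]
    simp only [Finset.sum_range_succ, Finset.sum_range_zero]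
    push_cast at hz2 ⊢
    simp only [Nat.factorial]
    push_cast
    linear_combination hz2
  rw [hrew, norm_mul]
  have hθnorm : ‖(θ N : ℂ)‖ = θ N := by simp
  rw [hθnorm]
  calc (θ N : ℝ) * ‖Complex.exp z - ∑ m ∈ Finset.range 3, z ^ m / m.factorial‖
      ≤ θ N * (‖z‖ ^ 3 * Real.exp ‖z‖) := by gcongr
    _ = t ^ 2 / 2 * (|t| / σ * Real.exp (|t| / σ)) := by
      rw [hznorm, ← sq_abs t]
      have : (θ N : ℝ) = σ ^ 2 / 2 := by linarith
      rw [this]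
      field_simp

theorem hasSum_exp_poisson (θ : NNReal) (c : ℝ) :
    HasSum (fun n : ℕ => Real.exp (-θ) * (θ : ℝ) ^ n / n.factorial * Real.exp (c * n))
      (Real.exp (θ * (Real.exp c - 1))) := by
  have h := (NormedSpace.expSeries_div_hasSum_exp ((θ : ℝ) * Real.exp c)).mul_left (Real.exp (-θ))
  rw [← Real.exp_eq_exp_ℝ, ← Real.exp_add] at h
  convert! h using 1
  · funext n
    rw [mul_pow, mul_comm c, Real.exp_nat_mul]
    ring
  · ring_nf

open ProbabilityTheory in
-- The integral is `exp (θ (e^c - 1 - c))` with `c² = 1/(2θ)`. The condition `θ ≥ 1` ensures `|c| ≤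
-- 1`, hence `e^c - 1 - c ≤ c²`, a bound independent of `θ`.
theorem integral_exp_scaledPoisson {θ : NNReal} (hθ : 1 ≤ θ) {u : ℝ} (hu : |u| = 1) :
    Integrable (fun s => Real.exp (u * s)) (scaledPoisson θ : Measure ℝ) ∧
      ∫ s, Real.exp (u * s) ∂(scaledPoisson θ : Measure ℝ) ≤ Real.exp (1 / 2) := by
  have hθ' : (1 : ℝ) ≤ θ := by exact_mod_cast hθ
  set σ := √(2 * (θ : ℝ)) with hσ
  have hσ2 : σ ^ 2 = 2 * θ := Real.sq_sqrt (by positivity)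
  have hσ1 : 1 ≤ σ := Real.one_le_sqrt.mpr (by linarith)
  let c := -(u / σ)
  have hc : |c| = 1 / σ := by
    rw [abs_neg, abs_div, hu, abs_of_pos (by linarith)]
  have hexp : ∀ n : ℕ, Real.exp (u * (((θ : ℝ) - n) / σ)) =
      Real.exp (-(θ * c)) * Real.exp (c * n) := by
    intro n
    rw [← Real.exp_add]
    congr 1
    simp only [c]
    ring
  have hsum := (hasSum_exp_poisson θ c).mul_left (Real.exp (-(θ * c)))
  have hint : Integrable (fun n : ℕ => Real.exp (u * (((θ : ℝ) - n) / σ))) (poissonMeasure θ) := by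
    rw [integrable_poissonMeasure_iff]
    refine hsum.summable.congr fun n => ?_
    rw [Real.norm_eq_abs, abs_of_pos (Real.exp_pos _), hexp]
    ring
  rw [coe_scaledPoisson]
  constructor
  · rw [integrable_map_measure (by fun_prop) .of_discrete]
    exact hint
  · rw [integral_map .of_discrete (by fun_prop), integral_poissonMeasure]
    have : ∑' n : ℕ, (Real.exp (-θ) * (θ : ℝ) ^ n / n.factorial) •
        Real.exp (u * (((θ : ℝ) - n) / σ)) =
        Real.exp (-(θ * c)) * Real.exp (θ * (Real.exp c - 1)) := by
      rw [← hsum.tsum_eq]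
      refine tsum_congr fun n => ?_
      rw [hexp, smul_eq_mul]
      ring
    rw [this, ← Real.exp_add, Real.exp_le_exp]
    have h1 := Real.abs_exp_sub_one_sub_id_le (x := c) (by
      rw [hc]; exact (div_le_one (by linarith)).mpr hσ1)
    have h2 : c ^ 2 = 1 / (2 * θ) := by
      rw [← sq_abs, hc, div_pow, hσ2]; norm_num
    have h3 := (le_abs_self _).trans h1
    rw [h2] at h3
    calc -(θ * c) + θ * (Real.exp c - 1) = θ * (Real.exp c - 1 - c) := by ring
      _ ≤ θ * (1 / (2 * θ)) := by gcongr
      _ = 1 / 2 := by field_simp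

theorem hasExpMomentBound_scaledPoisson {θ : NNReal} (hθ : 1 ≤ θ) :
    HasExpMomentBound (scaledPoisson θ : Measure ℝ) (Real.exp (1 / 2)) := by
  have h1 := integral_exp_scaledPoisson hθ (u := 1) (by simp)
  have h2 := integral_exp_scaledPoisson hθ (u := -1) (by simp)
  simp only [one_mul, neg_mul] at h1 h2
  exact ⟨h1.1, h2.1, h1.2, h2.2⟩

open ProbabilityTheory in
theorem hasExpMomentBound_gaussianHalf :
    HasExpMomentBound (gaussianHalf : Measure ℝ) (Real.exp (1 / 2)) := by
  have h1 := integrable_exp_mul_gaussianReal (μ := 0) (v := 1 / 2) 1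
  have h2 := integrable_exp_mul_gaussianReal (μ := 0) (v := 1 / 2) (-1)
  have h3 := congrFun (mgf_fun_id_gaussianReal (μ := 0) (v := 1 / 2)) 1
  have h4 := congrFun (mgf_fun_id_gaussianReal (μ := 0) (v := 1 / 2)) (-1)
  simp only [mgf, one_mul, neg_mul] at h1 h2 h3 h4
  -- The exact value is `exp (1/4)`; the larger bound matches the Poisson one.
  refine ⟨h1, h2, ?_, ?_⟩
  · rw [coe_gaussianHalf, h3]
    gcongr
    norm_num
  · rw [coe_gaussianHalf, h4]
    gcongr
    norm_num

/-! ### Rescaled Charlier polynomials and Hermite polynomials -/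

/-- The polynomials with `D_{n+1} = (ε n + 2 X) D_n - 2 n D_{n-1}`. They are the Hermite polynomials
for `ε = 0`, and rescaled Charlier polynomials for `ε > 0`. -/
def rescaledCharlier (ε : ℝ) : ℕ → Polynomial ℝ
  | 0 => 1
  | 1 => Polynomial.C (2 : ℝ) * Polynomial.X
  | n + 2 => (Polynomial.C (ε * ((n : ℝ) + 1)) + Polynomial.C (2 : ℝ) * Polynomial.X) *
      rescaledCharlier ε (n + 1) - Polynomial.C (2 * ((n : ℝ) + 1)) * rescaledCharlier ε n

theorem natDegree_rescaledCharlier_le (ε : ℝ) (n : ℕ) :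
    (rescaledCharlier ε n).natDegree ≤ n := by
  induction n using Nat.twoStepInduction with
  | zero => simp [rescaledCharlier]
  | one => exact (Polynomial.natDegree_C_mul_le _ _).trans Polynomial.natDegree_X_le
  | more n ih0 ih1 =>
    rw [rescaledCharlier]
    refine (Polynomial.natDegree_sub_le _ _).trans (max_le ?_ ?_)
    · refine (Polynomial.natDegree_mul_le_of_le (m := 1) ?_ ih1).trans (by omega)
      refine (Polynomial.natDegree_add_le _ _).trans (max_le ?_ ?_)
      · rw [Polynomial.natDegree_C]; omega
      · exact (Polynomial.natDegree_C_mul_le _ _).trans Polynomial.natDegree_X_le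
    · exact (Polynomial.natDegree_C_mul_le _ _).trans (by omega)

theorem continuous_coeff_mul {p q : ℝ → Polynomial ℝ}
    (hp : ∀ k, Continuous fun ε => (p ε).coeff k) (hq : ∀ k, Continuous fun ε => (q ε).coeff k)
    (k : ℕ) : Continuous fun ε => (p ε * q ε).coeff k := by
  simp only [Polynomial.coeff_mul]
  fun_prop

theorem continuous_coeff_rescaledCharlier (n k : ℕ) :
    Continuous fun ε => (rescaledCharlier ε n).coeff k := by
  induction n using Nat.twoStepInduction generalizing k with
  | zero => simp only [rescaledCharlier]; fun_prop
  | one => simp only [rescaledCharlier]; fun_prop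
  | more n ih0 ih1 =>
    simp only [rescaledCharlier, Polynomial.coeff_sub, Polynomial.coeff_C_mul]
    refine (continuous_coeff_mul (fun j => ?_) ih1 k).sub ((ih0 k).const_mul _)
    simp only [Polynomial.coeff_add, Polynomial.coeff_C]
    split_ifs <;> fun_prop

theorem Polynomial.derivative_hermite_succ (n : ℕ) :
    derivative (hermite (n + 1)) = (n + 1 : ℕ) * hermite n := by
  induction n with
  | zero => simp
  | succ n ih =>
    rw [hermite_succ (n + 1), ih, derivative_sub, derivative_mul, derivative_mul, ih,
      derivative_X, derivative_natCast, hermite_succ n]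
    push_cast
    ring

theorem hermiteH_succ_succ (n : ℕ) (t : ℝ) :
    hermiteH (n + 2) t = 2 * t * hermiteH (n + 1) t - 2 * (n + 1) * hermiteH n t := by
  have h2 : √2 * √2 = (2 : ℝ) := Real.mul_self_sqrt (by norm_num)
  rw [hermiteH, Polynomial.hermite_succ (n + 1), Polynomial.derivative_hermite_succ]
  simp only [hermiteH, map_sub, map_mul, Polynomial.aeval_X, map_natCast]
  push_cast
  linear_combination (√2 ^ n * √2 * t * (Polynomial.aeval (√2 * t)) (Polynomial.hermite (n + 1)) -
    √2 ^ n * (n + 1) * (Polynomial.aeval (√2 * t)) (Polynomial.hermite n)) * h2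

theorem rescaledCharlier_zero_eval (n : ℕ) (t : ℝ) :
    (rescaledCharlier 0 n).eval t = hermiteH n t := by
  induction n using Nat.twoStepInduction with
  | zero => simp [rescaledCharlier, hermiteH]
  | one =>
    have h2 : √2 * √2 = (2 : ℝ) := Real.mul_self_sqrt (by norm_num)
    simp [rescaledCharlier, hermiteH, ← mul_assoc, h2]
  | more n ih0 ih1 =>
    rw [hermiteH_succ_succ, ← ih0, ← ih1]
    simp [rescaledCharlier]

/-- Both sides satisfy the same recurrence: multiply the Charlier one by `2 σ^x` and use `σ² = 2θ`.
The shift `x + 1` in its middle coefficient produces the `ε` term, which disappears as `θ → ∞`. -/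
theorem rescaledCharlier_eval {θ : ℝ} (hθ : 0 < θ) (x n : ℕ) :
    (rescaledCharlier (2 / √(2 * θ)) x).eval ((θ - n) / √(2 * θ)) =
      √(2 * θ) ^ x * (charlierPoly θ x).eval (n : ℝ) := by
  set σ := √(2 * θ) with hσ
  have hσ2 : σ ^ 2 = 2 * θ := Real.sq_sqrt (by positivity)
  have hσ0 : 0 < σ := Real.sqrt_pos.mpr (by positivity)
  induction x using Nat.twoStepInduction with
  | zero => simp [rescaledCharlier]
  | one =>
    have h := charlierPoly_one_eval hθ.ne' (n : ℝ)
    simp only [rescaledCharlier, Polynomial.eval_mul, Polynomial.eval_C, Polynomial.eval_X]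
    rw [← h]
    field_simp
    rw [hσ2]
    ring
  | more x ih0 ih1 =>
    have h := charlierPoly_recurrence hθ.ne' x n
    simp only [rescaledCharlier, Polynomial.eval_mul, Polynomial.eval_C, Polynomial.eval_X,
      Polynomial.eval_add, Polynomial.eval_sub]
    rw [ih0, ih1]
    have e1 : (2 / σ * (x + 1) + 2 * ((θ - n) / σ)) *
        (σ ^ (x + 1) * (charlierPoly θ (x + 1)).eval (n : ℝ)) =
        2 * σ ^ x * ((θ + (x + 1) - n) * (charlierPoly θ (x + 1)).eval (n : ℝ)) := by
      field_simp
      ring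
    rw [e1, pow_add, hσ2]
    linear_combination (-2 * σ ^ x) * h

/-! ### Convergence of the kernels -/

theorem setIntegral_scaledPoisson {θ : NNReal} (hθ : 0 < θ) (N : ℕ) {f : ℝ → ℝ}
    (hf : Continuous f) :
    ∫ s in Set.Ioi (((θ : ℝ) - N) / √(2 * θ)), f s ∂(scaledPoisson θ : Measure ℝ) =
      ∑ n ∈ Finset.range N, (Real.exp (-θ) * (θ : ℝ) ^ n / n.factorial) *
        f (((θ : ℝ) - n) / √(2 * θ)) := by
  have hσ0 : 0 < √(2 * (θ : ℝ)) := Real.sqrt_pos.mpr (by positivity)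
  -- The scaling reverses order, and the open half-line excludes exactly `n = N`.
  have hpre : (fun n : ℕ => ((θ : ℝ) - n) / √(2 * θ)) ⁻¹' Set.Ioi (((θ : ℝ) - N) / √(2 * θ)) =
      (Finset.range N : Set ℕ) := by
    ext n
    rw [Set.mem_preimage, Set.mem_Ioi, div_lt_div_iff_of_pos_right hσ0, sub_lt_sub_iff_left,
      Nat.cast_lt, Finset.mem_coe, Finset.mem_range]
  rw [coe_scaledPoisson, setIntegral_map measurableSet_Ioi (by fun_prop) .of_discrete, hpre,
    setIntegral_finset]
  · refine Finset.sum_congr rfl fun n _ => ?_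
    rw [ProbabilityTheory.poissonMeasure_real_singleton, smul_eq_mul]
  · exact IntegrableOn.finset

theorem orthogonalPolynomialKernel_charlier_eq_setIntegral {θ : NNReal} (hθ : 0 < θ)
    (N x y : ℕ) :
    orthogonalPolynomialKernel (charlierWeight θ) (charlierPoly θ) N x y =
      (√(2 ^ (x + y) * (x.factorial : ℝ) * (y.factorial : ℝ)))⁻¹ *
        ∫ s in Set.Ioi (((θ : ℝ) - N) / √(2 * θ)),
          (rescaledCharlier (2 / √(2 * θ)) x * rescaledCharlier (2 / √(2 * θ)) y).eval s
            ∂(scaledPoisson θ : Measure ℝ) := by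
  have hθ' : (0 : ℝ) < θ := hθ
  rw [orthogonalPolynomialKernel_charlier_eq hθ', setIntegral_scaledPoisson hθ N
    (Polynomial.continuous _)]
  -- The weight at `(x, y)` supplies the powers of `√(2θ)` that rescale the two polynomials.
  have hs : √(charlierWeight θ x * charlierWeight θ y) =
      (√(2 ^ (x + y) * (x.factorial : ℝ) * (y.factorial : ℝ)))⁻¹ * √(2 * θ) ^ (x + y) := by
    rw [eq_inv_mul_iff_mul_eq₀ (by positivity), ← Real.sqrt_mul (by positivity)]
    rw [Real.sqrt_eq_iff_mul_self_eq (by simp only [charlierWeight]; positivity) (by positivity),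
      ← mul_pow, Real.mul_self_sqrt (by positivity)]
    simp only [charlierWeight]
    field_simp
    ring
  rw [hs, mul_assoc, Finset.mul_sum]
  congr 1
  refine Finset.sum_congr rfl fun n _ => ?_
  rw [Polynomial.eval_mul, rescaledCharlier_eval hθ', rescaledCharlier_eval hθ']
  ring

open ProbabilityTheory in
theorem discreteHermiteKernelPlus_eq (r : ℝ) (x y : ℕ) :
    discreteHermiteKernelPlus r x y =
      (√(2 ^ (x + y) * (x.factorial : ℝ) * (y.factorial : ℝ)))⁻¹ *
        ∫ s in Set.Ioi r, (rescaledCharlier 0 x * rescaledCharlier 0 y).eval s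
          ∂(gaussianHalf : Measure ℝ) := by
  have hv : ((1 / 2 : NNReal)) ≠ 0 := by norm_num
  rw [← integral_indicator measurableSet_Ioi, coe_gaussianHalf, integral_gaussianReal_eq_integral_smul hv]
  have hpt : ∀ s : ℝ, gaussianPDFReal 0 (1 / 2) s • (Set.Ioi r).indicator
      (fun s => (rescaledCharlier 0 x * rescaledCharlier 0 y).eval s) s =
      (√Real.pi)⁻¹ * (Set.Ioi r).indicator
        (fun s => hermiteH x s * hermiteH y s * Real.exp (-s ^ 2)) s := by
    intro s
    by_cases hs : s ∈ Set.Ioi r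
    · rw [Set.indicator_of_mem hs, Set.indicator_of_mem hs, gaussianPDFReal, Polynomial.eval_mul,
        rescaledCharlier_zero_eval, rescaledCharlier_zero_eval, smul_eq_mul]
      have e1 : 2 * Real.pi * ((1 / 2 : NNReal) : ℝ) = Real.pi := by push_cast; ring
      have e2 : -(s - 0) ^ 2 / (2 * ((1 / 2 : NNReal) : ℝ)) = -s ^ 2 := by push_cast; ring
      rw [e1, e2]
      ring
    · rw [Set.indicator_of_notMem hs, Set.indicator_of_notMem hs, smul_zero, mul_zero]
  simp only [hpt]
  rw [integral_const_mul, integral_indicator measurableSet_Ioi, discreteHermiteKernelPlus,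
    ← mul_assoc, ← mul_inv, ← Real.sqrt_mul (by positivity)]
  congr 3
  ring_nf

theorem tendsto_charlierKernel {r : ℝ} {θ : ℕ → ℝ}
    (hlim : Tendsto (fun N : ℕ => (θ N - (N : ℝ)) / √(N : ℝ)) atTop (𝓝 (√2 * r))) (x y : ℕ) :
    Tendsto (fun N => orthogonalPolynomialKernel (charlierWeight (θ N)) (charlierPoly (θ N)) N x y)
      atTop (𝓝 (discreteHermiteKernelPlus r x y)) := by
  have hsqrt : Tendsto (fun N : ℕ => √(N : ℝ)) atTop atTop :=
    Real.tendsto_sqrt_atTop.comp tendsto_natCast_atTop_atTop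
  have hratio : Tendsto (fun N : ℕ => θ N / N) atTop (𝓝 1) := by
    have h := (hlim.mul hsqrt.inv_tendsto_atTop).add_const 1
    rw [mul_zero, zero_add] at h
    refine h.congr' ?_
    filter_upwards [eventually_gt_atTop 0] with N hN
    have hN' : (0 : ℝ) < N := Nat.cast_pos.mpr hN
    have := Real.mul_self_sqrt hN'.le
    simp only [Pi.inv_apply]
    rw [← div_eq_mul_inv, div_div, this]
    field_simp
    ring
  have htop : Tendsto θ atTop atTop := by
    have h := hratio.pos_mul_atTop one_pos (tendsto_natCast_atTop_atTop (R := ℝ))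
    refine h.congr' ?_
    filter_upwards [eventually_gt_atTop 0] with N hN
    have hN' : (0 : ℝ) < N := Nat.cast_pos.mpr hN
    field_simp
  -- Clipping at zero is harmless: `θ N` is eventually positive.
  let ϑ : ℕ → NNReal := fun N => (θ N).toNNReal
  have hϑ : Tendsto ϑ atTop atTop := tendsto_real_toNNReal_atTop.comp htop
  have hσ : Tendsto (fun N => √(2 * (ϑ N : ℝ))) atTop atTop :=
    Real.tendsto_sqrt_atTop.comp ((NNReal.tendsto_coe_atTop.mpr hϑ).const_mul_atTop (by norm_num))
  have hε : Tendsto (fun N => 2 / √(2 * (ϑ N : ℝ))) atTop (𝓝 0) := hσ.const_div_atTop 2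
  have hpos : ∀ᶠ N in atTop, 0 < θ N := htop.eventually_gt_atTop 0
  have hrs : Tendsto (fun N : ℕ => ((ϑ N : ℝ) - N) / √(2 * ϑ N)) atTop (𝓝 r) := by
    -- Replacing `√N` by `√(2θ)` divides the limit `√2 r` by `√2`.
    have h := hlim.div ((Real.continuous_sqrt.tendsto _).comp (hratio.const_mul 2)) (by simp)
    have e : √2 * r / √(2 * 1) = r := by
      rw [mul_one]; field_simp
    rw [e] at h
    refine h.congr' ?_
    filter_upwards [hpos, eventually_gt_atTop 0] with N hN hN0
    have hN' : (0 : ℝ) < N := Nat.cast_pos.mpr hN0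
    have hc : (ϑ N : ℝ) = θ N := Real.coe_toNNReal _ hN.le
    rw [hc]
    simp only [Pi.div_apply, Function.comp_apply]
    rw [div_div, ← Real.sqrt_mul hN'.le]
    congr 2
    field_simp
  have hmain := tendsto_setIntegral_Ioi_eval (tendsto_scaledPoisson hϑ)
    (B := Real.exp (1 / 2))
    ((hϑ.eventually_ge_atTop 1).mono fun N hN => hasExpMomentBound_scaledPoisson hN)
    hasExpMomentBound_gaussianHalf hrs
    (ps := fun N => rescaledCharlier (2 / √(2 * (ϑ N : ℝ))) x *
      rescaledCharlier (2 / √(2 * (ϑ N : ℝ))) y)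
    (p := rescaledCharlier 0 x * rescaledCharlier 0 y) (d := x + y)
    (fun N => Polynomial.natDegree_mul_le_of_le (natDegree_rescaledCharlier_le _ _)
      (natDegree_rescaledCharlier_le _ _))
    (Polynomial.natDegree_mul_le_of_le (natDegree_rescaledCharlier_le _ _)
      (natDegree_rescaledCharlier_le _ _))
    (fun k => ((continuous_coeff_mul (continuous_coeff_rescaledCharlier x)
      (continuous_coeff_rescaledCharlier y) k).tendsto 0).comp hε)
  rw [discreteHermiteKernelPlus_eq]
  refine (hmain.const_mul _).congr' ?_
  filter_upwards [hpos] with N hN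
  have hc : (ϑ N : ℝ) = θ N := Real.coe_toNNReal _ hN.le
  rw [← hc]
  exact (orthogonalPolynomialKernel_charlier_eq_setIntegral (Real.toNNReal_pos.mpr hN) N x y).symm

end

/-- Convergence of the Charlier ensembles to the discrete Hermite ensemble. The convergence in
`ProbabilityMeasure (Conf ℕ)` is weak convergence of measures. -/
theorem mainTheorem8 (r : ℝ) (θ : ℕ → ℝ) (hθ : ∀ N : ℕ, 1 ≤ N → 0 < θ N)
    (hlim : Tendsto (fun N : ℕ => (θ N - (N : ℝ)) / √(N : ℝ)) atTop (𝓝 (√2 * r))) :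
    (∀ N : ℕ, 1 ≤ N → ∃! P : ProbabilityMeasure (Conf ℕ), IsCharlierEnsemble N (θ N) P) ∧
    (∃! Q : ProbabilityMeasure (Conf ℕ), IsDiscreteHermiteEnsemblePlus r Q) ∧
    (∀ (P : ℕ → ProbabilityMeasure (Conf ℕ)) (Q : ProbabilityMeasure (Conf ℕ)),
      (∀ N : ℕ, 1 ≤ N → IsCharlierEnsemble N (θ N) (P N)) →
      IsDiscreteHermiteEnsemblePlus r Q →
      Tendsto P atTop (𝓝 Q)) := by
  have hK := tendsto_charlierKernel hlim
  refine ⟨fun N hN => (isContractionKernel_charlier (hθ N hN) N).existsUnique_isDeterminantal,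
    ?_, fun P Q hP hQ => ?_⟩
  · refine (IsContractionKernel.of_tendsto (l := atTop) ?_ hK).existsUnique_isDeterminantal
    filter_upwards [eventually_ge_atTop 1] with N hN
    exact isContractionKernel_charlier (hθ N hN) N
  · exact IsDeterminantal.tendsto ((eventually_ge_atTop 1).mono hP) hQ hK
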